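/- Let $P$ be a partially ordered set in which every element has a rank $0$ (a vertex), $1$ (an edge) or $2$ (a face), with $F<G$ only if $\operatorname{rank} F<\operatorname{rank} G$. Call $F,G$ incident if $F\le G$ or $G\le F$. A flag is a triple consisting of a vertex, an edge and a face that are mutually incident, and two flags are adjacent if they differ in exactly one element. $P$ is an (abstract) polyhedron if (1) every edge is incident to exactly two vertices and exactly two faces; (2) whenever a vertex is incident to a face, exactly two edges are incident to both; (3) the graph of the incidence relation (on distinct elements) is non-empty and connected; (4) for every vertex or face $F$, the subgraph of this graph induced by the neighbours of $F$ is non-empty and connected. A polyhedron has type (Schläfli symbol) $\{p,q\}$ if every face is a $p$-gon (is incident to exactly $p$ edges) and every vertex is incident to exactly $q$ edges. A polyhedron of type $\{p,q\}$ is tight if it has exactly $2pq$ flags. A polyhedron is chiral if its flags can be partitioned into two non-empty classes such that two flags are related by an automorphism (order automorphism of $P$) if and only if they lie in the same class, and any two adjacent flags lie in different classes. **Theorem.** For all positive integers $r$ and $s$ there exists a tight chiral polyhedron of type $\{8r, 32s\}$. -/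

import Mathlib

/-- Two elements of a partial order are *incident* if one of them is below the other. -/
def Incident {P : Type*} [PartialOrder P] (F G : P) : Prop := F ≤ G ∨ G ≤ F

/-- The graph of the incidence relation: distinct elements are adjacent iff they are incident. -/
def incidenceGraph (P : Type*) [PartialOrder P] : SimpleGraph P where
  Adj F G := F ≠ G ∧ Incident F G
  symm := ⟨fun _ _ h => ⟨h.1.symm, h.2.symm⟩⟩
  loopless := ⟨fun _ h => h.1 rfl⟩

/-- The structure of an *abstract polyhedron* on a partially ordered set `P`: the elements have
ranks `0` (vertices), `1` (edges) and `2` (faces), and the four axioms of a polyhedron hold. -/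
structure AbstractPolyhedron (P : Type*) [PartialOrder P] where
  /-- the rank of an element -/
  rank : P → Fin 3
  /-- the order is compatible with the ranks -/
  rank_strictMono : StrictMono rank
  /-- every edge is incident to exactly two vertices -/
  edge_vertices : ∀ e, rank e = 1 → {v | rank v = 0 ∧ Incident v e}.encard = 2
  /-- every edge is incident to exactly two faces -/
  edge_faces : ∀ e, rank e = 1 → {f | rank f = 2 ∧ Incident e f}.encard = 2
  /-- whenever a vertex is incident to a face, exactly two edges are incident to both -/
  vertex_face_edges : ∀ v f, rank v = 0 → rank f = 2 → Incident v f →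
    {e | rank e = 1 ∧ Incident v e ∧ Incident e f}.encard = 2
  /-- the incidence graph is connected (in particular `P` is not empty) -/
  connected : (incidenceGraph P).Connected
  /-- the neighbours of a vertex or face induce a connected subgraph of the incidence graph -/
  locally_connected : ∀ F, rank F = 0 ∨ rank F = 2 →
    ((incidenceGraph P).induce ((incidenceGraph P).neighborSet F)).Connected

namespace AbstractPolyhedron

variable {P : Type*} [PartialOrder P] (M : AbstractPolyhedron P)

/-- A *flag*: a vertex, an edge and a face that are mutually incident. -/
structure Flag where
  /-- the element of rank `i` of the flag -/
  elem : Fin 3 → P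
  rank_elem : ∀ i, M.rank (elem i) = i
  incident : ∀ i j, Incident (elem i) (elem j)

/-- Two flags are *adjacent* if they differ in exactly one element. -/
def Adjacent (Φ Ψ : M.Flag) : Prop :=
  ∃ i, Φ.elem i ≠ Ψ.elem i ∧ ∀ j, j ≠ i → Φ.elem j = Ψ.elem j

/-- Some automorphism (a bijection of `P` preserving the order in both directions) sends the
flag `Φ` to the flag `Ψ`. -/
def SameOrbit (Φ Ψ : M.Flag) : Prop :=
  ∃ g : P ≃o P, ∀ i, g (Φ.elem i) = Ψ.elem i

/-- A polyhedron is *chiral* if its flags fall into two (non-empty) classes, `C` and its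
complement, such that two flags are related by an automorphism if and only if they lie in the same
class, and adjacent flags lie in different classes. -/
def IsChiral : Prop :=
  ∃ C : Set M.Flag, C.Nonempty ∧ Cᶜ.Nonempty ∧
    (∀ Φ Ψ, M.SameOrbit Φ Ψ ↔ (Φ ∈ C ↔ Ψ ∈ C)) ∧
    (∀ Φ Ψ, M.Adjacent Φ Ψ → (Φ ∈ C ↔ Ψ ∉ C))

/-- A polyhedron has *Schläfli symbol* `{p, q}` if every face is a `p`-gon, that is, incident to
exactly `p` edges, and every vertex is `q`-valent, that is, incident to exactly `q` edges.
(By the axioms, the edges and vertices at a face, and the edges and faces at a vertex, then form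
a single cycle.) -/
def HasType (p q : ℕ) : Prop :=
  (∀ f, M.rank f = 2 → {e | M.rank e = 1 ∧ Incident e f}.encard = p) ∧
  (∀ v, M.rank v = 0 → {e | M.rank e = 1 ∧ Incident v e}.encard = q)

/-- A polyhedron is *tight* if it has some Schläfli symbol `{p, q}` and exactly `2pq` flags. -/
def IsTight : Prop :=
  ∃ p q : ℕ, M.HasType p q ∧ ENat.card M.Flag = 2 * p * q

end AbstractPolyhedron

/-- A pair of generators `x`, `y` of a group `G = ⟨x⟩⟨y⟩` with `⟨x⟩ ∩ ⟨y⟩ = 1`, where `x` has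
order `p`, `y` has order `q`, `x * y` is an involution, and no endomorphism of `G` inverts both `x`
and `y`: the rotation group of a tight chiral polyhedron of type `{p, q}`. -/
structure IsTightChiralPair {G : Type*} [Group G] (x y : G) (p q : ℕ) : Prop where
  three_le_left : 3 ≤ p
  three_le_right : 3 ≤ q
  mul_mul_self : x * y * (x * y) = 1
  factor : ∀ g : G, ∃ a b : ℤ, g = x ^ a * y ^ b
  free : ∀ a b : ℤ, x ^ a * y ^ b = 1 ↔ (p : ℤ) ∣ a ∧ (q : ℤ) ∣ b
  not_inverted : ∀ f : G →* G, f x = x⁻¹ → f y ≠ y⁻¹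

/-- The stabilizers of the vertex, the edge and the face of a base flag. -/
def flagSubgroup {G : Type*} [Group G] (x y : G) : Fin 3 → Subgroup G :=
  ![Subgroup.zpowers y, Subgroup.zpowers (x * y), Subgroup.zpowers x]

/-- The cosets of the three stabilizers. -/
def CosetGeometry {G : Type*} [Group G] (x y : G) : Type _ := Σ i, G ⧸ flagSubgroup x y i

namespace CosetGeometry

variable {G : Type*} [Group G] {x y : G} {p q : ℕ}

/-- The coset of `g` of type `i`. -/
def coset (x y : G) (i : Fin 3) (g : G) : CosetGeometry x y := ⟨i, (g : G ⧸ flagSubgroup x y i)⟩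

/-- The type of a coset. -/
def type (F : CosetGeometry x y) : Fin 3 := F.1

@[simp] theorem type_coset (i : Fin 3) (g : G) : (coset x y i g).type = i := rfl

theorem exists_coset (F : CosetGeometry x y) : ∃ g, F = coset x y F.type g := by
  obtain ⟨i, c⟩ := F
  obtain ⟨g, rfl⟩ := QuotientGroup.mk_surjective c
  exact ⟨g, rfl⟩

theorem exists_coset_of_type {F : CosetGeometry x y} {i : Fin 3} (h : F.type = i) :
    ∃ g, F = coset x y i g := h ▸ F.exists_coset

theorem coset_eq_coset {i j : Fin 3} {g h : G} :
    coset x y i g = coset x y j h ↔ i = j ∧ g⁻¹ * h ∈ flagSubgroup x y i := by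
  constructor
  · intro e
    obtain rfl : i = j := congrArg type e
    exact ⟨rfl, QuotientGroup.eq.1 (eq_of_heq (Sigma.mk.inj e).2)⟩
  · rintro ⟨rfl, e⟩
    exact congrArg (Sigma.mk i) (QuotientGroup.eq.2 e)

theorem vertex_eq {g h : G} : coset x y 0 g = coset x y 0 h ↔ ∃ k : ℤ, h = g * y ^ k := by
  simp only [coset_eq_coset, flagSubgroup, true_and, Matrix.cons_val_zero, Subgroup.mem_zpowers_iff]
  exact exists_congr fun k => by rw [eq_inv_mul_iff_mul_eq, eq_comm]

theorem face_eq {g h : G} : coset x y 2 g = coset x y 2 h ↔ ∃ k : ℤ, h = g * x ^ k := by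
  simp only [coset_eq_coset, flagSubgroup, true_and, Matrix.cons_val, Subgroup.mem_zpowers_iff]
  exact exists_congr fun k => by rw [eq_inv_mul_iff_mul_eq, eq_comm]

theorem edge_eq (hxy : x * y * (x * y) = 1) {g h : G} :
    coset x y 1 g = coset x y 1 h ↔ h = g ∨ h = g * (x * y) := by
  simp only [coset_eq_coset, flagSubgroup, true_and, Matrix.cons_val_one, Matrix.cons_val_zero,
    Subgroup.mem_zpowers_iff]
  constructor
  · rintro ⟨k, hk⟩
    rw [eq_inv_mul_iff_mul_eq] at hk
    rcases Int.even_or_odd' k with ⟨m, rfl | rfl⟩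
    · left; rw [← hk, zpow_mul, zpow_two, hxy]; simp
    · right; rw [← hk, zpow_add, zpow_mul, zpow_two, hxy]; simp
  · rintro (rfl | rfl)
    · exact ⟨0, by simp⟩
    · exact ⟨1, by simp⟩

/-- Two cosets meet. -/
def Meet (F F' : CosetGeometry x y) : Prop := ∃ k, coset x y F.type k = F ∧ coset x y F'.type k = F'

theorem Meet.symm {F F' : CosetGeometry x y} (h : Meet F F') : Meet F' F :=
  let ⟨k, h1, h2⟩ := h; ⟨k, h2, h1⟩

theorem meet_coset (i j : Fin 3) (g : G) : Meet (coset x y i g) (coset x y j g) := ⟨g, rfl, rfl⟩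

theorem Meet.refl (F : CosetGeometry x y) : Meet F F := by
  obtain ⟨g, hg⟩ := F.exists_coset
  rw [hg]; exact meet_coset _ _ g

theorem Meet.eq_of_type_eq {F F' : CosetGeometry x y} (h : Meet F F') (e : F.type = F'.type) :
    F = F' := by
  obtain ⟨k, h1, h2⟩ := h
  rw [← h1, ← h2, e]

end CosetGeometry

namespace IsTightChiralPair

open CosetGeometry

variable {G : Type*} [Group G] {x y : G} {p q : ℕ}

theorem zpow_left_eq_one (H : IsTightChiralPair x y p q) {a : ℤ} :
    x ^ a = 1 ↔ (p : ℤ) ∣ a := by simpa using H.free a 0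

theorem zpow_right_eq_one (H : IsTightChiralPair x y p q) {b : ℤ} :
    y ^ b = 1 ↔ (q : ℤ) ∣ b := by simpa using H.free 0 b

theorem dvd_of_zpow_eq_zpow (H : IsTightChiralPair x y p q) {a b : ℤ} (h : x ^ a = y ^ b) :
    (p : ℤ) ∣ a ∧ (q : ℤ) ∣ b := by
  have := (H.free a (-b)).1 (by rw [h, ← zpow_add, add_neg_cancel, zpow_zero])
  exact ⟨this.1, (dvd_neg).1 this.2⟩

theorem left_ne_zpow (H : IsTightChiralPair x y p q) (b : ℤ) : x ≠ y ^ b := fun h => by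
  have h1 := (H.dvd_of_zpow_eq_zpow (a := 1) (by rwa [zpow_one])).1
  have := H.three_le_left
  have := Int.le_of_dvd one_pos h1
  omega

theorem right_ne_zpow (H : IsTightChiralPair x y p q) (a : ℤ) : y ≠ x ^ a := fun h => by
  have h1 := (H.dvd_of_zpow_eq_zpow (a := a) (b := 1) (by rw [zpow_one, ← h])).2
  have := H.three_le_right
  have := Int.le_of_dvd one_pos h1
  omega

theorem right_mul_left (H : IsTightChiralPair x y p q) : y * x = x⁻¹ * y⁻¹ := by
  have h : x * (y * x) * y = 1 := by simpa only [mul_assoc] using H.mul_mul_self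
  rw [eq_inv_mul_iff_mul_eq, eq_inv_iff_mul_eq_one, h]

theorem left_mul_right (H : IsTightChiralPair x y p q) : x * y = y⁻¹ * x⁻¹ := by
  rw [← mul_inv_rev]; exact eq_inv_of_mul_eq_one_left H.mul_mul_self

theorem edge_eq (H : IsTightChiralPair x y p q) {g h : G} :
    coset x y 1 g = coset x y 1 h ↔ h = g ∨ h = g * (x * y) :=
  CosetGeometry.edge_eq H.mul_mul_self

theorem edge_mul (H : IsTightChiralPair x y p q) (g : G) :
    coset x y 1 (g * (x * y)) = coset x y 1 g :=
  (H.edge_eq.2 (Or.inr rfl)).symm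

theorem vertex_mul_right (g : G) (k : ℤ) : coset x y 0 (g * y ^ k) = coset x y 0 g :=
  (vertex_eq.2 ⟨k, rfl⟩).symm

theorem face_mul_left (g : G) (k : ℤ) : coset x y 2 (g * x ^ k) = coset x y 2 g :=
  (face_eq.2 ⟨k, rfl⟩).symm

theorem vertex_mul (g : G) : coset x y 0 (g * (x * y)) = coset x y 0 (g * x) := by
  simpa [mul_assoc] using vertex_mul_right (x := x) (y := y) (g * x) 1

theorem face_mul (H : IsTightChiralPair x y p q) (g : G) :
    coset x y 2 (g * (x * y)) = coset x y 2 (g * y⁻¹) := by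
  rw [H.left_mul_right]
  simpa [mul_assoc] using face_mul_left (x := x) (y := y) (g * y⁻¹) (-1)

theorem vertex_ne (H : IsTightChiralPair x y p q) (g : G) :
    coset x y 0 (g * x) ≠ coset x y 0 g := fun h => by
  obtain ⟨k, hk⟩ := vertex_eq.1 h.symm
  exact H.left_ne_zpow k (mul_left_cancel hk)

theorem face_ne (H : IsTightChiralPair x y p q) (g : G) :
    coset x y 2 (g * y) ≠ coset x y 2 g := fun h => by
  obtain ⟨k, hk⟩ := face_eq.1 h.symm
  exact H.right_ne_zpow k (mul_left_cancel hk)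

theorem edge_zpow_right_eq (H : IsTightChiralPair x y p q) (g : G) (k l : ℤ) :
    coset x y 1 (g * y ^ k) = coset x y 1 (g * y ^ l) ↔ (q : ℤ) ∣ l - k := by
  rw [H.edge_eq, ← H.zpow_right_eq_one, zpow_sub, mul_inv_eq_one, mul_assoc, mul_right_inj,
    mul_right_inj, or_iff_left]
  intro h
  apply H.left_ne_zpow (-k + l + -1)
  rw [zpow_add, zpow_add, h]
  group

theorem edge_zpow_left_eq (H : IsTightChiralPair x y p q) (g : G) (k l : ℤ) :
    coset x y 1 (g * x ^ k) = coset x y 1 (g * x ^ l) ↔ (p : ℤ) ∣ l - k := by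
  rw [H.edge_eq, ← H.zpow_left_eq_one, zpow_sub, mul_inv_eq_one, mul_assoc, mul_right_inj,
    mul_right_inj, or_iff_left]
  intro h
  apply H.right_ne_zpow (-1 + -k + l)
  rw [zpow_add, zpow_add, h]
  group

theorem edge_ne (H : IsTightChiralPair x y p q) (g : G) :
    coset x y 1 (g * y) ≠ coset x y 1 g := fun h => by
  have h1 := (H.edge_zpow_right_eq g 1 0).1 (by simpa using h)
  have := H.three_le_right
  have := Int.le_of_dvd one_pos ((dvd_neg).1 (by simpa using h1))
  omega

theorem eq_of_vertex_face (H : IsTightChiralPair x y p q) {g h : G}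
    (hv : coset x y 0 g = coset x y 0 h) (hf : coset x y 2 g = coset x y 2 h) : g = h := by
  obtain ⟨b, rfl⟩ := vertex_eq.1 hv
  obtain ⟨a, ha⟩ := face_eq.1 hf
  have h1 := H.zpow_right_eq_one.2 (H.dvd_of_zpow_eq_zpow (mul_left_cancel ha).symm).2
  rw [h1, mul_one]

theorem exists_vertex_face (H : IsTightChiralPair x y p q) {v f : CosetGeometry x y}
    (hv : v.type = 0) (hf : f.type = 2) : ∃ g, v = coset x y 0 g ∧ f = coset x y 2 g := by
  obtain ⟨g, rfl⟩ := exists_coset_of_type hv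
  obtain ⟨h, rfl⟩ := exists_coset_of_type hf
  obtain ⟨a, b, hab⟩ := H.factor (h⁻¹ * g)
  refine ⟨g * y ^ (-b), (vertex_mul_right g _).symm, ?_⟩
  rw [← face_mul_left h a, show h * x ^ a = g * y ^ (-b) from ?_]
  rw [inv_mul_eq_iff_eq_mul] at hab
  rw [hab]; group

theorem meet_vertex_face (H : IsTightChiralPair x y p q) {v f : CosetGeometry x y}
    (hv : v.type = 0) (hf : f.type = 2) : Meet v f := by
  obtain ⟨g, rfl, rfl⟩ := H.exists_vertex_face hv hf
  exact meet_coset _ _ g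

theorem meet_edge_vertex (H : IsTightChiralPair x y p q) {g : G} {v : CosetGeometry x y}
    (hv : v.type = 0) :
    Meet v (coset x y 1 g) ↔ v = coset x y 0 g ∨ v = coset x y 0 (g * x) := by
  constructor
  · rintro ⟨k, h1, h2⟩
    rw [hv] at h1
    rcases H.edge_eq.1 h2.symm with rfl | rfl
    · exact Or.inl h1.symm
    · exact Or.inr (by rw [← h1, vertex_mul])
  · rintro (rfl | rfl)
    · exact meet_coset _ _ g
    · rw [← vertex_mul, ← H.edge_mul g]; exact meet_coset _ _ _

theorem meet_edge_face (H : IsTightChiralPair x y p q) {g : G} {f : CosetGeometry x y}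
    (hf : f.type = 2) :
    Meet (coset x y 1 g) f ↔ f = coset x y 2 g ∨ f = coset x y 2 (g * y⁻¹) := by
  constructor
  · rintro ⟨k, h1, h2⟩
    rw [hf] at h2
    rcases H.edge_eq.1 h1.symm with rfl | rfl
    · exact Or.inl h2.symm
    · exact Or.inr (by rw [← h2, H.face_mul])
  · rintro (rfl | rfl)
    · exact meet_coset _ _ g
    · rw [← H.face_mul, ← H.edge_mul g]; exact meet_coset _ _ _

theorem meet_vertex_edge (g : G) {e : CosetGeometry x y} (he : e.type = 1) :
    Meet (coset x y 0 g) e ↔ ∃ k : ℤ, e = coset x y 1 (g * y ^ k) := by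
  constructor
  · rintro ⟨k, h1, h2⟩
    rw [he] at h2
    obtain ⟨m, rfl⟩ := vertex_eq.1 h1.symm
    exact ⟨m, h2.symm⟩
  · rintro ⟨k, rfl⟩
    rw [← vertex_mul_right g k]; exact meet_coset _ _ _

theorem meet_face_edge (g : G) {e : CosetGeometry x y} (he : e.type = 1) :
    Meet e (coset x y 2 g) ↔ ∃ k : ℤ, e = coset x y 1 (g * x ^ k) := by
  constructor
  · rintro ⟨k, h1, h2⟩
    rw [he] at h1
    obtain ⟨m, rfl⟩ := face_eq.1 h2.symm
    exact ⟨m, h1.symm⟩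
  · rintro ⟨k, rfl⟩
    rw [← face_mul_left g k]; exact meet_coset _ _ _

theorem meet_vertex_edge_face (H : IsTightChiralPair x y p q) (g : G) {e : CosetGeometry x y}
    (he : e.type = 1) :
    Meet (coset x y 0 g) e ∧ Meet e (coset x y 2 g) ↔ e = coset x y 1 g ∨ e = coset x y 1 (g * y) := by
  constructor
  · rintro ⟨h1, h2⟩
    obtain ⟨k, rfl⟩ := (meet_vertex_edge g he).1 h1
    rcases (H.meet_edge_face rfl).1 h2 with h | h
    · exact Or.inl (congrArg _ (H.eq_of_vertex_face (vertex_mul_right g k) h.symm))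
    · right
      obtain ⟨m, hm⟩ := face_eq.1 h
      have h3 : x ^ m = y ^ (k - 1) := by
        rw [zpow_sub_one]; exact (mul_left_cancel (a := g) (by rw [← hm, mul_assoc])).symm
      have h4 := H.zpow_right_eq_one.2 (H.dvd_of_zpow_eq_zpow h3).2
      rw [zpow_sub_one, mul_inv_eq_one] at h4
      rw [h4]
  · rintro (rfl | rfl)
    · exact ⟨meet_coset _ _ g, meet_coset _ _ g⟩
    · exact ⟨(meet_vertex_edge g rfl).2 ⟨1, by simp⟩, (H.meet_edge_face rfl).2 (by simp)⟩

end IsTightChiralPair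

namespace IsTightChiralPair

open CosetGeometry

variable {G : Type*} [Group G] {x y : G} {p q : ℕ}

/-- The order of the coset geometry. -/
@[reducible]
def partialOrder (H : IsTightChiralPair x y p q) : PartialOrder (CosetGeometry x y) where
  le F F' := F.type ≤ F'.type ∧ Meet F F'
  le_refl F := ⟨le_rfl, Meet.refl F⟩
  le_antisymm F F' h h' := h.2.eq_of_type_eq (le_antisymm h.1 h'.1)
  le_trans F F' F'' h h' := by
    refine ⟨h.1.trans h'.1, ?_⟩
    rcases h.1.eq_or_lt with e | e
    · rw [h.2.eq_of_type_eq e]; exact h'.2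
    rcases h'.1.eq_or_lt with e' | e'
    · rw [← h'.2.eq_of_type_eq e']; exact h.2
    exact H.meet_vertex_face (by omega) (by omega)

theorem incident_iff (H : IsTightChiralPair x y p q) {F F' : CosetGeometry x y} :
    letI := H.partialOrder
    Incident F F' ↔ Meet F F' := by
  constructor
  · rintro (h | h)
    exacts [h.2, h.2.symm]
  · intro h
    rcases le_total F.type F'.type with e | e
    exacts [Or.inl ⟨e, h⟩, Or.inr ⟨e, h.symm⟩]

theorem reachable_vertex_link (H : IsTightChiralPair x y p q) (g : G) :
    letI := H.partialOrder
    ((incidenceGraph (CosetGeometry x y)).induce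
      ((incidenceGraph (CosetGeometry x y)).neighborSet (coset x y 0 g))).Connected := by
  let _ := H.partialOrder
  have hV (F : CosetGeometry x y) : F ∈ (incidenceGraph (CosetGeometry x y)).neighborSet
      (coset x y 0 g) ↔ coset x y 0 g ≠ F ∧ Meet (coset x y 0 g) F := by
    rw [← H.incident_iff]; rfl
  have hE (k : ℤ) : coset x y 1 (g * y ^ k) ∈ (incidenceGraph (CosetGeometry x y)).neighborSet
      (coset x y 0 g) :=
    (hV _).2 ⟨fun h => absurd (congrArg type h) (by simp), (meet_vertex_edge g rfl).2 ⟨k, rfl⟩⟩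
  have hF (k : ℤ) : coset x y 2 (g * y ^ k) ∈ (incidenceGraph (CosetGeometry x y)).neighborSet
      (coset x y 0 g) :=
    (hV _).2 ⟨fun h => absurd (congrArg type h) (by simp), H.meet_vertex_face rfl rfl⟩
  have h1 (k : ℤ) : ((incidenceGraph (CosetGeometry x y)).induce _).Adj
      ⟨_, hE k⟩ ⟨_, hF k⟩ :=
    ⟨fun h => absurd (congrArg type h) (by simp), H.incident_iff.2 (meet_coset _ _ _)⟩
  have h2 (k : ℤ) : ((incidenceGraph (CosetGeometry x y)).induce _).Adj
      ⟨_, hE (k + 1)⟩ ⟨_, hF k⟩ :=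
    ⟨fun h => absurd (congrArg type h) (by simp), H.incident_iff.2
      ((H.meet_edge_face rfl).2 (Or.inr
        (congrArg (coset x y 2) (show g * y ^ k = g * y ^ (k + 1) * y⁻¹ by group))))⟩
  have h3 (k : ℤ) : ((incidenceGraph (CosetGeometry x y)).induce _).Reachable
      ⟨_, hE 0⟩ ⟨_, hE k⟩ := by
    induction k with
    | zero => rfl
    | succ k ih => exact ih.trans ((h1 _).reachable.trans (h2 _).reachable.symm)
    | pred k ih =>
      refine ih.trans (SimpleGraph.Reachable.trans ?_ (h1 (-(k : ℤ) - 1)).reachable.symm)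
      have := h2 (-(k : ℤ) - 1)
      simp only [sub_add_cancel] at this
      exact this.reachable
  have h4 : ∀ F, ((incidenceGraph (CosetGeometry x y)).induce _).Reachable ⟨_, hE 0⟩ F := by
    rintro ⟨F, hFm⟩
    have hm := (hV F).1 hFm
    have : F.type = 0 ∨ F.type = 1 ∨ F.type = 2 := by omega
    rcases this with h | h | h
    · exact absurd (hm.2.eq_of_type_eq h.symm) hm.1
    · obtain ⟨k, rfl⟩ := (meet_vertex_edge g h).1 hm.2
      exact h3 k
    · obtain ⟨k, hk, hk'⟩ := hm.2
      obtain ⟨m, rfl⟩ := vertex_eq.1 hk.symm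
      rw [h] at hk'
      subst hk'
      exact (h3 m).trans (h1 m).reachable
  have : Nonempty ((incidenceGraph (CosetGeometry x y)).neighborSet (coset x y 0 g)) :=
    ⟨⟨_, hE 0⟩⟩
  exact ⟨fun F F' => (h4 F).symm.trans (h4 F')⟩

theorem reachable_face_link (H : IsTightChiralPair x y p q) (g : G) :
    letI := H.partialOrder
    ((incidenceGraph (CosetGeometry x y)).induce
      ((incidenceGraph (CosetGeometry x y)).neighborSet (coset x y 2 g))).Connected := by
  let _ := H.partialOrder
  have hV (F : CosetGeometry x y) : F ∈ (incidenceGraph (CosetGeometry x y)).neighborSet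
      (coset x y 2 g) ↔ coset x y 2 g ≠ F ∧ Meet (coset x y 2 g) F := by
    rw [← H.incident_iff]; rfl
  have hE (k : ℤ) : coset x y 1 (g * x ^ k) ∈ (incidenceGraph (CosetGeometry x y)).neighborSet
      (coset x y 2 g) :=
    (hV _).2 ⟨fun h => absurd (congrArg type h) (by simp),
      ((meet_face_edge g rfl).2 ⟨k, rfl⟩).symm⟩
  have hF (k : ℤ) : coset x y 0 (g * x ^ k) ∈ (incidenceGraph (CosetGeometry x y)).neighborSet
      (coset x y 2 g) :=
    (hV _).2 ⟨fun h => absurd (congrArg type h) (by simp), (H.meet_vertex_face rfl rfl).symm⟩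
  have h1 (k : ℤ) : ((incidenceGraph (CosetGeometry x y)).induce _).Adj
      ⟨_, hE k⟩ ⟨_, hF k⟩ :=
    ⟨fun h => absurd (congrArg type h) (by simp), H.incident_iff.2 (meet_coset _ _ _)⟩
  have h2 (k : ℤ) : ((incidenceGraph (CosetGeometry x y)).induce _).Adj
      ⟨_, hE k⟩ ⟨_, hF (k + 1)⟩ :=
    ⟨fun h => absurd (congrArg type h) (by simp), H.incident_iff.2
      ((H.meet_edge_vertex rfl).2 (Or.inr
        (congrArg (coset x y 0) (show g * x ^ (k + 1) = g * x ^ k * x by group)))).symm⟩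
  have h3 (k : ℤ) : ((incidenceGraph (CosetGeometry x y)).induce _).Reachable
      ⟨_, hE 0⟩ ⟨_, hE k⟩ := by
    induction k with
    | zero => rfl
    | succ k ih => exact ih.trans ((h2 _).reachable.trans (h1 _).reachable.symm)
    | pred k ih =>
      refine ih.trans (SimpleGraph.Reachable.trans ?_ (h2 (-(k : ℤ) - 1)).reachable.symm)
      simp only [sub_add_cancel]
      exact (h1 _).reachable
  have h4 : ∀ F, ((incidenceGraph (CosetGeometry x y)).induce _).Reachable ⟨_, hE 0⟩ F := by
    rintro ⟨F, hFm⟩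
    have hm := (hV F).1 hFm
    have : F.type = 0 ∨ F.type = 1 ∨ F.type = 2 := by omega
    rcases this with h | h | h
    · obtain ⟨k, hk, hk'⟩ := hm.2
      obtain ⟨m, rfl⟩ := face_eq.1 hk.symm
      rw [h] at hk'
      subst hk'
      exact (h3 m).trans (h1 m).reachable
    · obtain ⟨k, rfl⟩ := (meet_face_edge g h).1 hm.2.symm
      exact h3 k
    · exact absurd (hm.2.eq_of_type_eq h.symm) hm.1
  have : Nonempty ((incidenceGraph (CosetGeometry x y)).neighborSet (coset x y 2 g)) :=
    ⟨⟨_, hE 0⟩⟩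
  exact ⟨fun F F' => (h4 F).symm.trans (h4 F')⟩

theorem connected (H : IsTightChiralPair x y p q) :
    letI := H.partialOrder
    (incidenceGraph (CosetGeometry x y)).Connected := by
  let _ := H.partialOrder
  have hvf (g h : G) : (incidenceGraph (CosetGeometry x y)).Adj (coset x y 0 g)
      (coset x y 2 h) :=
    ⟨fun h => absurd (congrArg type h) (by simp),
      H.incident_iff.2 (H.meet_vertex_face rfl rfl)⟩
  have h4 : ∀ F, (incidenceGraph (CosetGeometry x y)).Reachable (coset x y 2 1) F := by
    intro F
    obtain ⟨g, hg⟩ := F.exists_coset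
    have : F.type = 0 ∨ F.type = 1 ∨ F.type = 2 := by omega
    rcases this with h | h | h <;> rw [h] at hg <;> subst hg
    · exact (hvf g 1).symm.reachable
    · have : (incidenceGraph (CosetGeometry x y)).Adj (coset x y 0 g) (coset x y 1 g) :=
        ⟨fun h => absurd (congrArg type h) (by simp), H.incident_iff.2 (meet_coset _ _ _)⟩
      exact (hvf g 1).symm.reachable.trans this.reachable
    · exact (hvf 1 1).symm.reachable.trans (hvf 1 g).reachable
  have : Nonempty (CosetGeometry x y) := ⟨coset x y 2 1⟩
  exact ⟨fun F F' => (h4 F).symm.trans (h4 F')⟩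

/-- The abstract polyhedron of a tight chiral pair. -/
@[reducible]
def polyhedron (H : IsTightChiralPair x y p q) :
    @AbstractPolyhedron (CosetGeometry x y) H.partialOrder :=
  letI := H.partialOrder
  { rank := type
    rank_strictMono := fun F F' h => lt_of_le_of_ne h.le.1
      fun e => h.ne (h.le.2.eq_of_type_eq e)
    edge_vertices := by
      intro e he
      obtain ⟨g, rfl⟩ := exists_coset_of_type he
      rw [← Set.encard_pair (H.vertex_ne g).symm]
      congr 1
      ext v
      simp only [Set.mem_ofPred_eq, Set.mem_insert_iff, Set.mem_singleton_iff, H.incident_iff]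
      constructor
      · rintro ⟨h, h'⟩
        exact (H.meet_edge_vertex h).1 h'
      · intro h
        have hv : v.type = 0 := by rcases h with rfl | rfl <;> rfl
        exact ⟨hv, (H.meet_edge_vertex hv).2 h⟩
    edge_faces := by
      intro e he
      obtain ⟨g, rfl⟩ := exists_coset_of_type he
      have hne : coset x y 2 g ≠ coset x y 2 (g * y⁻¹) := by
        simpa using H.face_ne (g * y⁻¹)
      rw [← Set.encard_pair hne]
      congr 1
      ext f
      simp only [Set.mem_ofPred_eq, Set.mem_insert_iff, Set.mem_singleton_iff, H.incident_iff]
      constructor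
      · rintro ⟨h, h'⟩
        exact (H.meet_edge_face h).1 h'
      · intro h
        have hv : f.type = 2 := by rcases h with rfl | rfl <;> rfl
        exact ⟨hv, (H.meet_edge_face hv).2 h⟩
    vertex_face_edges := by
      intro v f hv hf _
      obtain ⟨g, rfl, rfl⟩ := H.exists_vertex_face hv hf
      rw [← Set.encard_pair (H.edge_ne g).symm]
      congr 1
      ext e
      simp only [Set.mem_ofPred_eq, Set.mem_insert_iff, Set.mem_singleton_iff, H.incident_iff]
      constructor
      · rintro ⟨h, h'⟩
        exact (H.meet_vertex_edge_face g h).1 h'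
      · intro h
        have he : e.type = 1 := by rcases h with rfl | rfl <;> rfl
        exact ⟨he, (H.meet_vertex_edge_face g he).2 h⟩
    connected := H.connected
    locally_connected := by
      rintro F (h | h)
      · obtain ⟨g, rfl⟩ := exists_coset_of_type h
        exact H.reachable_vertex_link g
      · obtain ⟨g, rfl⟩ := exists_coset_of_type h
        exact H.reachable_face_link g }

end IsTightChiralPair

/-- The range of a function on the integers that is injective modulo `n`. -/
theorem encard_range_int {α : Type*} {f : ℤ → α} {n : ℕ} (hn : 0 < n)
    (hf : ∀ k l, f k = f l ↔ (n : ℤ) ∣ l - k) : (Set.range f).encard = n := by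
  have h1 : Set.range f = f '' Set.Ico (0 : ℤ) n := by
    refine subset_antisymm ?_ (Set.image_subset_range _ _)
    rintro _ ⟨k, rfl⟩
    refine ⟨k % n, ⟨Int.emod_nonneg _ (by omega), Int.emod_lt_of_pos _ (by omega)⟩, ?_⟩
    exact (hf _ _).2 (Int.dvd_self_sub_emod)
  have h2 : Set.InjOn f (Set.Ico (0 : ℤ) n) := by
    intro k hk l hl e
    have := (hf _ _).1 e
    have h3 := Int.eq_zero_of_abs_lt_dvd this (by rw [abs_lt]; constructor <;>
      linarith [hk.1, hk.2, hl.1, hl.2])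
    omega
  rw [h1, h2.encard_image, ← Finset.coe_Ico, Set.encard_coe_eq_coe_finsetCard]
  simp

namespace IsTightChiralPair

open CosetGeometry

variable {G : Type*} [Group G] {x y : G} {p q : ℕ}

theorem hasType (H : IsTightChiralPair x y p q) :
    letI := H.partialOrder
    H.polyhedron.HasType p q := by
  have := H.three_le_left
  have := H.three_le_right
  constructor
  · intro f hf
    obtain ⟨g, rfl⟩ := exists_coset_of_type hf
    rw [← encard_range_int (by omega) (H.edge_zpow_left_eq g)]
    congr 1
    ext e
    simp only [Set.mem_ofPred_eq, Set.mem_range, H.incident_iff]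
    constructor
    · rintro ⟨h, h'⟩
      obtain ⟨k, rfl⟩ := (meet_face_edge g h).1 h'
      exact ⟨k, rfl⟩
    · rintro ⟨k, rfl⟩
      exact ⟨rfl, (meet_face_edge g rfl).2 ⟨k, rfl⟩⟩
  · intro f hf
    obtain ⟨g, rfl⟩ := exists_coset_of_type hf
    rw [← encard_range_int (by omega) (H.edge_zpow_right_eq g)]
    congr 1
    ext e
    simp only [Set.mem_ofPred_eq, Set.mem_range, H.incident_iff]
    constructor
    · rintro ⟨h, h'⟩
      obtain ⟨k, rfl⟩ := (meet_vertex_edge g h).1 h'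
      exact ⟨k, rfl⟩
    · rintro ⟨k, rfl⟩
      exact ⟨rfl, (meet_vertex_edge g rfl).2 ⟨k, rfl⟩⟩

end IsTightChiralPair

namespace IsTightChiralPair

open CosetGeometry

variable {G : Type*} [Group G] {x y : G} {p q : ℕ}

/-- The elements of the two flags at the vertex and the face of `g`. -/
def flagElem (x y : G) (g : G) (b : Bool) (i : Fin 3) : CosetGeometry x y :=
  coset x y i (if b = true ∧ i = 1 then g * y else g)

@[simp] theorem flagElem_zero (g : G) (b : Bool) : flagElem x y g b 0 = coset x y 0 g := by
  simp [flagElem]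

@[simp] theorem flagElem_two (g : G) (b : Bool) : flagElem x y g b 2 = coset x y 2 g := by
  simp [flagElem]

@[simp] theorem flagElem_false_one (g : G) : flagElem x y g false 1 = coset x y 1 g := by
  simp [flagElem]

@[simp] theorem flagElem_true_one (g : G) : flagElem x y g true 1 = coset x y 1 (g * y) := by
  simp [flagElem]

/-- The two flags at the vertex and the face of `g`. -/
def flag (H : IsTightChiralPair x y p q) (g : G) (b : Bool) :
    @AbstractPolyhedron.Flag _ H.partialOrder H.polyhedron :=
  letI := H.partialOrder
  { elem := flagElem x y g b
    rank_elem := fun _ => rfl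
    incident := fun i j => by
      rw [H.incident_iff]
      have h1 : Meet (coset x y 0 g) (flagElem x y g b 1) ∧
          Meet (flagElem x y g b 1) (coset x y 2 g) := by
        rw [H.meet_vertex_edge_face g rfl]
        cases b <;> simp
      fin_cases i <;> fin_cases j
      · exact Meet.refl _
      · exact (flagElem_zero (x := x) (y := y) g b) ▸ h1.1
      · exact H.meet_vertex_face rfl rfl
      · exact ((flagElem_zero (x := x) (y := y) g b) ▸ h1.1).symm
      · exact Meet.refl _
      · exact (flagElem_two (x := x) (y := y) g b) ▸ h1.2
      · exact (H.meet_vertex_face rfl rfl).symm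
      · exact ((flagElem_two (x := x) (y := y) g b) ▸ h1.2).symm
      · exact Meet.refl _ }

theorem flag_ext (H : IsTightChiralPair x y p q)
    {Φ Ψ : @AbstractPolyhedron.Flag _ H.partialOrder H.polyhedron}
    (h0 : @AbstractPolyhedron.Flag.elem _ H.partialOrder _ Φ 0 =
      @AbstractPolyhedron.Flag.elem _ H.partialOrder _ Ψ 0)
    (h1 : @AbstractPolyhedron.Flag.elem _ H.partialOrder _ Φ 1 =
      @AbstractPolyhedron.Flag.elem _ H.partialOrder _ Ψ 1)
    (h2 : @AbstractPolyhedron.Flag.elem _ H.partialOrder _ Φ 2 =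
      @AbstractPolyhedron.Flag.elem _ H.partialOrder _ Ψ 2) : Φ = Ψ := by
  obtain ⟨e, _, _⟩ := Φ
  obtain ⟨e', _, _⟩ := Ψ
  obtain rfl : e = e' := by
    funext i
    fin_cases i
    exacts [h0, h1, h2]
  rfl

theorem flag_bijective (H : IsTightChiralPair x y p q) :
    Function.Bijective fun s : G × Bool => H.flag s.1 s.2 := by
  let _ := H.partialOrder
  constructor
  · rintro ⟨g, b⟩ ⟨h, c⟩ e
    have e' : flagElem x y g b = flagElem x y h c := congrArg AbstractPolyhedron.Flag.elem e
    obtain rfl : g = h := H.eq_of_vertex_face (by simpa using congrFun e' 0)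
      (by simpa using congrFun e' 2)
    have h1 := congrFun e' 1
    cases b <;> cases c <;> simp only [flagElem_false_one, flagElem_true_one] at h1
    · rfl
    · exact absurd h1.symm (H.edge_ne g)
    · exact absurd h1 (H.edge_ne g)
    · rfl
  · intro Φ
    have hr := Φ.rank_elem
    have hi := fun i j => H.incident_iff.1 (Φ.incident i j)
    obtain ⟨g, hv, hf⟩ := H.exists_vertex_face (hr 0) (hr 2)
    have h01 := hi 0 1
    have h12 := hi 1 2
    rw [hv] at h01
    rw [hf] at h12
    rcases (H.meet_vertex_edge_face g (hr 1)).1 ⟨h01, h12⟩ with h | h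
    · refine ⟨(g, false), H.flag_ext ?_ ?_ ?_⟩
      · exact (flagElem_zero g _).trans hv.symm
      · exact (flagElem_false_one g).trans h.symm
      · exact (flagElem_two g _).trans hf.symm
    · refine ⟨(g, true), H.flag_ext ?_ ?_ ?_⟩
      · exact (flagElem_zero g _).trans hv.symm
      · exact (flagElem_true_one g).trans h.symm
      · exact (flagElem_two g _).trans hf.symm

theorem card_group (H : IsTightChiralPair x y p q) : ENat.card G = p * q := by
  have hp := H.three_le_left
  have hq := H.three_le_right
  have hb : Function.Bijective fun s : Fin p × Fin q => x ^ (s.1 : ℤ) * y ^ (s.2 : ℤ) := by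
    constructor
    · rintro ⟨a, b⟩ ⟨c, d⟩ h
      simp only at h
      have h' : x ^ (-(c : ℤ) + a) = y ^ ((d : ℤ) - b) := by
        rw [zpow_add, zpow_sub, zpow_neg, inv_mul_eq_iff_eq_mul, ← mul_assoc, ← h]
        group
      obtain ⟨h1, h2⟩ := H.dvd_of_zpow_eq_zpow h'
      have h3 := Int.eq_zero_of_abs_lt_dvd h1 (by rw [abs_lt]; constructor <;> omega)
      have h4 := Int.eq_zero_of_abs_lt_dvd h2 (by rw [abs_lt]; constructor <;> omega)
      ext <;> simp only <;> omega
    · intro g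
      obtain ⟨a, b, rfl⟩ := H.factor g
      have hmod (n : ℕ) (hn : 3 ≤ n) (k : ℤ) : ((k % n).toNat : ℤ) = k % n :=
        Int.toNat_of_nonneg (Int.emod_nonneg _ (by omega))
      have hlt (n : ℕ) (hn : 3 ≤ n) (k : ℤ) : (k % n).toNat < n := by
        have := hmod n hn k
        have := Int.emod_lt_of_pos k (show (0 : ℤ) < n by omega)
        omega
      have hx : x ^ (a % p) = x ^ a := by
        rw [← mul_inv_eq_one, ← zpow_sub, H.zpow_left_eq_one]
        exact (Int.dvd_self_sub_emod (x := a)).neg_right.trans (by simp)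
      have hy : y ^ (b % q) = y ^ b := by
        rw [← mul_inv_eq_one, ← zpow_sub, H.zpow_right_eq_one]
        exact (Int.dvd_self_sub_emod (x := b)).neg_right.trans (by simp)
      refine ⟨(⟨_, hlt p hp a⟩, ⟨_, hlt q hq b⟩), ?_⟩
      simp only [hmod p hp, hmod q hq, hx, hy]
  rw [← ENat.card_congr (Equiv.ofBijective _ hb)]
  simp

theorem isTight (H : IsTightChiralPair x y p q) :
    letI := H.partialOrder
    H.polyhedron.IsTight := by
  refine ⟨p, q, H.hasType, ?_⟩
  rw [← ENat.card_congr (Equiv.ofBijective _ H.flag_bijective), ENat.card_prod, H.card_group]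
  simp
  ring

/-- Left multiplication by `g`, on cosets. -/
def smul (g : G) (F : CosetGeometry x y) : CosetGeometry x y := ⟨F.1, g • F.2⟩

theorem smul_coset (g : G) (i : Fin 3) (h : G) :
    smul g (coset x y i h) = coset x y i (g * h) := rfl

theorem smul_smul_inv (g : G) (F : CosetGeometry x y) : smul g (smul g⁻¹ F) = F := by
  obtain ⟨h, hh⟩ := F.exists_coset
  rw [hh, smul_coset, smul_coset, mul_inv_cancel_left]

theorem meet_smul {g : G} {F F' : CosetGeometry x y} (h : Meet F F') :
    Meet (smul g F) (smul g F') := by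
  obtain ⟨k, h1, h2⟩ := h
  rw [← h1, ← h2]
  exact meet_coset _ _ _

/-- Left multiplication by `g`, as an automorphism of the coset geometry. -/
def leftMul (H : IsTightChiralPair x y p q) (g : G) :
    letI := H.partialOrder
    CosetGeometry x y ≃o CosetGeometry x y :=
  letI := H.partialOrder
  { toFun := smul g
    invFun := smul g⁻¹
    left_inv := fun F => by simpa using smul_smul_inv g⁻¹ F
    right_inv := smul_smul_inv g
    map_rel_iff' := fun {F F'} => by
      refine ⟨fun h => ⟨h.1, ?_⟩, fun h => ⟨h.1, meet_smul h.2⟩⟩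
      have h1 := meet_smul (g := g⁻¹) h.2
      have h2 := smul_smul_inv g⁻¹ F
      have h3 := smul_smul_inv g⁻¹ F'
      rw [inv_inv] at h2 h3
      change Meet (smul g⁻¹ (smul g F)) (smul g⁻¹ (smul g F')) at h1
      rwa [h2, h3] at h1 }

end IsTightChiralPair

namespace IsTightChiralPair

open CosetGeometry

variable {G : Type*} [Group G] {x y : G} {p q : ℕ}

theorem map_meet (H : IsTightChiralPair x y p q)
    (φ : letI := H.partialOrder; CosetGeometry x y ≃o CosetGeometry x y)
    {F F' : CosetGeometry x y} (h : Meet F F') : Meet (φ F) (φ F') := by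
  let _ := H.partialOrder
  rw [← H.incident_iff] at h ⊢
  exact h.imp φ.monotone.imp φ.monotone.imp

theorem type_map (H : IsTightChiralPair x y p q)
    (φ : letI := H.partialOrder; CosetGeometry x y ≃o CosetGeometry x y)
    (i : Fin 3) (g : G) : (φ (coset x y i g)).type = i := by
  let _ := H.partialOrder
  have hlt {i j : Fin 3} (h : i < j) : (φ (coset x y i g)).type < (φ (coset x y j g)).type :=
    H.polyhedron.rank_strictMono (φ.strictMono (lt_of_le_of_ne ⟨h.le, meet_coset _ _ _⟩
      fun e => h.ne (congrArg type e)))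
  have h1 := hlt (show (0 : Fin 3) < 1 by decide)
  have h2 := hlt (show (1 : Fin 3) < 2 by decide)
  fin_cases i <;> simp <;> omega

/-- The automorphism `φ` maps the first flag at `g` to the second flag at `h`. -/
def MapsFlag (φ : CosetGeometry x y → CosetGeometry x y) (g h : G) : Prop :=
  φ (coset x y 0 g) = coset x y 0 h ∧ φ (coset x y 1 g) = coset x y 1 (h * y) ∧
    φ (coset x y 2 g) = coset x y 2 h

theorem mapsFlag_left (H : IsTightChiralPair x y p q)
    (φ : letI := H.partialOrder; CosetGeometry x y ≃o CosetGeometry x y)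
    {g h : G} (hgh : MapsFlag φ g h) : MapsFlag φ (g * x) (h * x⁻¹) := by
  let _ := H.partialOrder
  obtain ⟨hv, he, hf⟩ := hgh
  have hyx : h * y * x = h * x⁻¹ * y⁻¹ := by rw [mul_assoc, H.right_mul_left, mul_assoc]
  have f1 : φ (coset x y 2 (g * x)) = coset x y 2 (h * x⁻¹) := by
    have h1 := face_mul_left (x := x) (y := y) g 1
    have h2 := face_mul_left (x := x) (y := y) h (-1)
    simp only [zpow_one, zpow_neg] at h1 h2
    rw [h1, h2, hf]
  have v1 : φ (coset x y 0 (g * x)) = coset x y 0 (h * x⁻¹) := by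
    have h1 := H.map_meet φ ((H.meet_edge_vertex rfl).2 (Or.inr (rfl : coset x y 0 (g * x) = _)))
    rw [he, H.meet_edge_vertex (H.type_map φ 0 _)] at h1
    have h2 := vertex_mul_right (x := x) (y := y) h 1
    have h3 := vertex_mul_right (x := x) (y := y) (h * x⁻¹) (-1)
    simp only [zpow_one, zpow_neg] at h2 h3
    rw [hyx, h2, h3, ← hv] at h1
    exact h1.resolve_left fun e => H.vertex_ne g (φ.injective e)
  have hg : coset x y 1 (g * x * y) = coset x y 1 g := by rw [mul_assoc, H.edge_mul]
  have hh : coset x y 1 (h * y) = coset x y 1 (h * x⁻¹) := by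
    rw [← H.edge_mul, ← mul_assoc, hyx, inv_mul_cancel_right]
  refine ⟨v1, ?_, f1⟩
  have h1 := H.map_meet φ (meet_coset 0 1 (g * x))
  have h2 := H.map_meet φ (meet_coset 1 2 (g * x))
  rw [v1] at h1
  rw [f1] at h2
  refine ((H.meet_vertex_edge_face _ (H.type_map φ 1 _)).1 ⟨h1, h2⟩).resolve_left fun e => ?_
  rw [← hh, ← he, ← hg] at e
  exact H.edge_ne _ (φ.injective e).symm

theorem mapsFlag_right (H : IsTightChiralPair x y p q)
    (φ : letI := H.partialOrder; CosetGeometry x y ≃o CosetGeometry x y)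
    {g h : G} (hgh : MapsFlag φ g h) : MapsFlag φ (g * y) (h * y⁻¹) := by
  let _ := H.partialOrder
  obtain ⟨hv, he, hf⟩ := hgh
  have v1 : φ (coset x y 0 (g * y)) = coset x y 0 (h * y⁻¹) := by
    have h1 := vertex_mul_right (x := x) (y := y) g 1
    have h2 := vertex_mul_right (x := x) (y := y) h (-1)
    simp only [zpow_one, zpow_neg] at h1 h2
    rw [h1, h2, hv]
  have e1 : φ (coset x y 1 (g * y)) = coset x y 1 h := by
    have h0 := (H.meet_vertex_edge_face g (e := coset x y 1 (g * y)) rfl).2 (Or.inr rfl)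
    have h1 := H.map_meet φ h0.1
    have h2 := H.map_meet φ h0.2
    rw [hv] at h1
    rw [hf] at h2
    refine ((H.meet_vertex_edge_face _ (H.type_map φ 1 _)).1 ⟨h1, h2⟩).resolve_right fun e => ?_
    rw [← he] at e
    exact H.edge_ne _ (φ.injective e)
  refine ⟨v1, by rw [e1, inv_mul_cancel_right], ?_⟩
  have h1 := H.map_meet φ (meet_coset 1 2 (g * y))
  rw [e1, H.meet_edge_face (H.type_map φ 2 _), ← hf] at h1
  exact h1.resolve_left fun e => H.face_ne g (φ.injective e)

theorem zpow_eq_pow (H : IsTightChiralPair x y p q) (a : ℤ) :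
    ∃ n : ℕ, x ^ a = x ^ n ∧ (x⁻¹) ^ a = (x⁻¹) ^ n := by
  have := H.three_le_left
  refine ⟨(a % p).toNat, ?_⟩
  have h1 : x ^ a = x ^ (a % p).toNat := by
    rw [← zpow_natCast, Int.toNat_of_nonneg (Int.emod_nonneg _ (by omega)), ← mul_inv_eq_one,
      ← zpow_sub, H.zpow_left_eq_one]
    exact Int.dvd_self_sub_emod
  exact ⟨h1, by rw [inv_zpow, inv_pow, h1]⟩

/-- Exchanging the two generators. -/
theorem dual (H : IsTightChiralPair x y p q) : IsTightChiralPair y⁻¹ x⁻¹ q p where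
  three_le_left := H.three_le_right
  three_le_right := H.three_le_left
  mul_mul_self := by rw [← H.left_mul_right, H.mul_mul_self]
  factor g := by
    obtain ⟨a, b, h⟩ := H.factor g⁻¹
    refine ⟨b, a, ?_⟩
    rw [← inv_inv g, h]
    simp
  free a b := by
    have := H.free b a
    rw [and_comm, ← this, ← inv_eq_one]
    simp
  not_inverted f hy hx := by
    simp only [map_inv, inv_inv] at hx hy
    exact H.not_inverted f (inv_eq_iff_eq_inv.1 hx) (inv_eq_iff_eq_inv.1 hy)

theorem not_mapsFlag_one (H : IsTightChiralPair x y p q)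
    (φ : letI := H.partialOrder; CosetGeometry x y ≃o CosetGeometry x y) :
    ¬ MapsFlag φ 1 1 := by
  let _ := H.partialOrder
  intro h11
  have hx {g h : G} (hgh : MapsFlag φ g h) (n : ℕ) : MapsFlag φ (g * x ^ n) (h * x⁻¹ ^ n) := by
    induction n with
    | zero => simpa using hgh
    | succ n ih => rw [pow_succ, pow_succ, ← mul_assoc, ← mul_assoc]; exact H.mapsFlag_left φ ih
  have hy {g h : G} (hgh : MapsFlag φ g h) (n : ℕ) : MapsFlag φ (g * y ^ n) (h * y⁻¹ ^ n) := by
    induction n with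
    | zero => simpa using hgh
    | succ n ih => rw [pow_succ, pow_succ, ← mul_assoc, ← mul_assoc]; exact H.mapsFlag_right φ ih
  have hfac (g : G) : ∃ a b : ℕ, g = x ^ a * y ^ b := by
    obtain ⟨a, b, rfl⟩ := H.factor g
    obtain ⟨m, hm, -⟩ := H.zpow_eq_pow a
    obtain ⟨n, -, hn⟩ := H.dual.zpow_eq_pow b
    exact ⟨m, n, by rw [hm]; simpa using hn⟩
  have huniq {g h h' : G} (h1 : MapsFlag φ g h) (h2 : MapsFlag φ g h') : h = h' :=
    H.eq_of_vertex_face (h1.1.symm.trans h2.1) (h1.2.2.symm.trans h2.2.2)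
  have hex (g : G) : ∃ h, MapsFlag φ g h := by
    obtain ⟨a, b, rfl⟩ := hfac g
    have := hy (hx h11 a) b
    rw [one_mul] at this
    exact ⟨_, this⟩
  choose f hf using hex
  have f1 : f 1 = 1 := huniq (hf 1) h11
  have hmul (g h : G) : f (g * h) = f g * f h := by
    obtain ⟨a, b, rfl⟩ := hfac h
    have h1 := huniq (hf _) (hy (hx (hf g) a) b)
    have h2 := huniq (hf _) (hy (hx (hf 1) a) b)
    rw [one_mul, f1, one_mul] at h2
    rw [h2, ← mul_assoc, h1, mul_assoc]
  refine H.not_inverted (MonoidHom.mk' f hmul) ?_ ?_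
  · have := huniq (hf _) (hx (hf 1) 1)
    simpa [f1] using this
  · have := huniq (hf _) (hy (hf 1) 1)
    simpa [f1] using this

theorem eq_of_vertex_edge (H : IsTightChiralPair x y p q) {g h : G}
    (hv : coset x y 0 g = coset x y 0 h) (he : coset x y 1 g = coset x y 1 h) : g = h := by
  rcases H.edge_eq.1 he with rfl | rfl
  · rfl
  · rw [vertex_mul] at hv
    exact absurd hv.symm (H.vertex_ne g)

theorem eq_of_edge_face (H : IsTightChiralPair x y p q) {g h : G}
    (he : coset x y 1 g = coset x y 1 h) (hf : coset x y 2 g = coset x y 2 h) : g = h := by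
  rcases H.edge_eq.1 he with rfl | rfl
  · rfl
  · rw [H.face_mul] at hf
    exact absurd (by simpa using hf) (H.face_ne (g * y⁻¹))

theorem eq_of_flag_vertex_edge (H : IsTightChiralPair x y p q) {g h : G} {b : Bool}
    (hv : coset x y 0 g = coset x y 0 h) (he : flagElem x y g b 1 = flagElem x y h b 1) :
    g = h := by
  cases b
  · simp only [flagElem_false_one] at he
    exact H.eq_of_vertex_edge hv he
  · simp only [flagElem_true_one] at he
    have h1 (g : G) : coset x y 0 (g * y) = coset x y 0 g := by
      simpa using vertex_mul_right (x := x) (y := y) g 1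
    rw [← h1 g, ← h1 h] at hv
    exact mul_right_cancel (H.eq_of_vertex_edge hv he)

theorem eq_of_flag_edge_face (H : IsTightChiralPair x y p q) {g h : G} {b : Bool}
    (he : flagElem x y g b 1 = flagElem x y h b 1) (hf : coset x y 2 g = coset x y 2 h) :
    g = h := by
  cases b
  · simp only [flagElem_false_one] at he
    exact H.eq_of_edge_face he hf
  · simp only [flagElem_true_one] at he
    have h1 (g : G) : coset x y 2 (g * x⁻¹) = coset x y 2 g := by
      simpa using face_mul_left (x := x) (y := y) g (-1)
    have h2 (g : G) : coset x y 1 (g * y) = coset x y 1 (g * x⁻¹) := by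
      rw [← H.edge_mul, H.left_mul_right]; group
    rw [← h1 g, ← h1 h] at hf
    rw [h2, h2] at he
    exact mul_right_cancel (H.eq_of_edge_face he hf)

theorem isChiral (H : IsTightChiralPair x y p q) :
    letI := H.partialOrder
    H.polyhedron.IsChiral := by
  let _ := H.partialOrder
  have hmem (g : G) (b : Bool) : H.flag g b ∈ Set.range (fun g => H.flag g false) ↔ b = false := by
    constructor
    · rintro ⟨h, hh⟩
      exact (Prod.ext_iff.1 (H.flag_bijective.1 (a₁ := (h, false)) (a₂ := (g, b)) hh)).2.symm
    · rintro rfl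
      exact ⟨g, rfl⟩
  have hL (g h : G) (b : Bool) : H.polyhedron.SameOrbit (H.flag g b) (H.flag h b) := by
    refine ⟨H.leftMul (h * g⁻¹), fun i => ?_⟩
    change smul (h * g⁻¹) (coset x y i _) = coset x y i _
    rw [smul_coset]
    congr 1
    split_ifs <;> group
  have hsymm {Φ Ψ : H.polyhedron.Flag} (h : H.polyhedron.SameOrbit Φ Ψ) :
      H.polyhedron.SameOrbit Ψ Φ := by
    obtain ⟨φ, hφ⟩ := h
    exact ⟨φ.symm, fun i => by rw [← hφ, OrderIso.symm_apply_apply]⟩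
  have htrans {Φ Ψ Θ : H.polyhedron.Flag} (h : H.polyhedron.SameOrbit Φ Ψ)
      (h' : H.polyhedron.SameOrbit Ψ Θ) : H.polyhedron.SameOrbit Φ Θ := by
    obtain ⟨φ, hφ⟩ := h
    obtain ⟨ψ, hψ⟩ := h'
    exact ⟨φ.trans ψ, fun i => by rw [OrderIso.trans_apply, hφ, hψ]⟩
  have hne (g h : G) : ¬ H.polyhedron.SameOrbit (H.flag g false) (H.flag h true) := by
    intro hs
    obtain ⟨φ, hφ⟩ := htrans (hL 1 g false) (htrans hs (hL h 1 true))
    apply H.not_mapsFlag_one φ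
    refine ⟨(hφ 0).trans (flagElem_zero _ _), (hφ 1).trans (flagElem_true_one _), ?_⟩
    exact (hφ 2).trans (flagElem_two _ _)
  refine ⟨Set.range fun g => H.flag g false, ⟨_, ⟨1, rfl⟩⟩,
    ⟨H.flag 1 true, fun h => absurd ((hmem 1 true).1 h) (by simp)⟩, ?_, ?_⟩
  · intro Φ Ψ
    obtain ⟨⟨g, b⟩, rfl⟩ := H.flag_bijective.2 Φ
    obtain ⟨⟨h, c⟩, rfl⟩ := H.flag_bijective.2 Ψ
    simp only [hmem]
    cases b <;> cases c
    · simp [hL]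
    · simp [hne]
    · simpa using fun e => hne _ _ (hsymm e)
    · simp [hL]
  · intro Φ Ψ
    obtain ⟨⟨g, b⟩, rfl⟩ := H.flag_bijective.2 Φ
    obtain ⟨⟨h, c⟩, rfl⟩ := H.flag_bijective.2 Ψ
    simp only [hmem]
    have key (b : Bool) : ¬ H.polyhedron.Adjacent (H.flag g b) (H.flag h b) := by
      rintro ⟨i, hi, hj⟩
      apply hi
      suffices e : g = h by rw [e]
      have h1 := hj 1
      have h2 := hj 2
      have h0 := hj 0
      have hi' : i = 0 ∨ i = 1 ∨ i = 2 := by omega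
      rcases hi' with rfl | rfl | rfl
      · exact H.eq_of_flag_edge_face (h1 (by decide)) (by simpa [flag] using h2 (by decide))
      · exact H.eq_of_vertex_face (by simpa [flag] using h0 (by decide)) (by simpa [flag] using h2 (by decide))
      · exact H.eq_of_flag_vertex_edge (by simpa [flag] using h0 (by decide)) (h1 (by decide))
    cases b <;> cases c
    · exact fun e => absurd e (key _)
    · simp
    · simp
    · exact fun e => absurd e (key _)

end IsTightChiralPair

theorem zpow_apply_of_succ {Ω : Type*} {g : Equiv.Perm Ω} {f : ℤ → Ω → Ω}
    (h0 : ∀ s, f 0 s = s) (h : ∀ k s, g (f k s) = f (k + 1) s) (k : ℤ) (s : Ω) :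
    (g ^ k) s = f k s := by
  induction k with
  | zero => exact (h0 s).symm
  | succ k ih => rw [add_comm, zpow_one_add, Equiv.Perm.mul_apply, ih, h, add_comm]
  | pred k ih =>
    apply g.injective
    rw [h, ← Equiv.Perm.mul_apply, ← zpow_one_add, add_sub_cancel, ih, sub_add_cancel]

/-- Data on an abelian group `M` from which the permutations `TwistedModule.x` and
`TwistedModule.y` of `M × Bool` are built. -/
structure TwistedModule (M : Type*) [AddCommGroup M] where
  /-- the translation by which `x ^ 2` acts -/
  e₁ : M
  /-- the translation by which `y` acts at `0` -/
  e₂ : M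
  /-- the shear that `y` induces on `M` -/
  κ : M →+ M
  κ_e₂ : κ e₂ = 0
  κ_κ : ∀ m, κ (κ m) = 0
  four_κ : ∀ m, (4 : ℤ) • κ m = 0

namespace TwistedModule

variable {M : Type*} [AddCommGroup M] (T : TwistedModule M)

/-- The permutation `x`, whose square is a translation. -/
def x : Equiv.Perm (M × Bool) where
  toFun s := (bif s.2 then s.1 + T.e₁ else s.1, !s.2)
  invFun s := (bif s.2 then s.1 else s.1 - T.e₁, !s.2)
  left_inv := by rintro ⟨m, _ | _⟩ <;> simp
  right_inv := by rintro ⟨m, _ | _⟩ <;> simp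

/-- The permutation `y`, which shears both copies of `M`. -/
def y : Equiv.Perm (M × Bool) where
  toFun s := (bif s.2 then s.1 - T.κ s.1 - T.e₁ - T.e₂ else s.1 + T.κ s.1 + T.e₂, s.2)
  invFun s := (bif s.2 then s.1 + T.κ s.1 + T.e₁ + T.e₂ + T.κ T.e₁ else
    s.1 - T.κ s.1 - T.e₂, s.2)
  left_inv := by
    rintro ⟨m, _ | _⟩ <;> simp [T.κ_κ, T.κ_e₂] <;> abel
  right_inv := by
    rintro ⟨m, _ | _⟩ <;> simp [T.κ_κ, T.κ_e₂] <;> abel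

@[simp] theorem x_false (m : M) : T.x (m, false) = (m, true) := rfl

@[simp] theorem x_true (m : M) : T.x (m, true) = (m + T.e₁, false) := rfl

@[simp] theorem y_false (m : M) : T.y (m, false) = (m + T.κ m + T.e₂, false) := rfl

@[simp] theorem y_true (m : M) : T.y (m, true) = (m - T.κ m - T.e₁ - T.e₂, true) := rfl

@[simp] theorem y_inv_false (m : M) : T.y⁻¹ (m, false) = (m - T.κ m - T.e₂, false) := rfl

@[simp] theorem y_inv_true (m : M) :
    T.y⁻¹ (m, true) = (m + T.κ m + T.e₁ + T.e₂ + T.κ T.e₁, true) := rfl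

theorem mul_mul_self : T.x * T.y * (T.x * T.y) = 1 := by
  ext1 ⟨m, b⟩
  cases b <;> simp [T.κ_κ, T.κ_e₂] <;> abel

theorem x_zpow_two_mul (i : ℤ) (m : M) (b : Bool) :
    (T.x ^ (2 * i)) (m, b) = (m + i • T.e₁, b) := by
  rw [zpow_mul]
  refine zpow_apply_of_succ (f := fun i s => (s.1 + i • T.e₁, s.2)) (by simp) ?_ i (m, b)
  rintro k ⟨m, b⟩
  rw [zpow_two]
  cases b <;> simp [add_smul, add_assoc]

theorem x_zpow_two_mul_add_one (i : ℤ) (s : M × Bool) :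
    (T.x ^ (2 * i + 1)) s = ((T.x s).1 + i • T.e₁, (T.x s).2) := by
  rw [zpow_add_one, Equiv.Perm.mul_apply, ← x_zpow_two_mul]

theorem y_zpow (j : ℤ) (s : M × Bool) : (T.y ^ j) s = (bif s.2 then
    s.1 - j • (T.κ s.1 + T.e₁ + T.e₂) + (j * (j - 1) / 2) • T.κ T.e₁ else
    s.1 + j • (T.κ s.1 + T.e₂), s.2) := by
  refine zpow_apply_of_succ (g := T.y) (f := fun j s => (bif s.2 then
    s.1 - j • (T.κ s.1 + T.e₁ + T.e₂) + (j * (j - 1) / 2) • T.κ T.e₁ else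
    s.1 + j • (T.κ s.1 + T.e₂), s.2)) ?_ ?_ j s
  · rintro ⟨m, b⟩
    cases b <;> simp
  · rintro k ⟨m, b⟩
    have ht : (k + 1) * (k + 1 - 1) / 2 = k * (k - 1) / 2 + k := by
      rw [← Int.add_mul_ediv_left _ _ two_ne_zero]; congr 1; ring
    cases b
    · simp only [cond_false, y_false, map_add, map_zsmul, T.κ_κ, T.κ_e₂]
      congr 1; module
    · simp only [cond_true, y_true, map_add, map_sub, map_zsmul, T.κ_κ, T.κ_e₂, ht]
      congr 1; module

theorem y_zpow_false (j : ℤ) (m : M) :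
    (T.y ^ j) (m, false) = (m + j • (T.κ m + T.e₂), false) := T.y_zpow j _

theorem y_zpow_true (j : ℤ) (m : M) : (T.y ^ j) (m, true) =
    (m - j • (T.κ m + T.e₁ + T.e₂) + (j * (j - 1) / 2) • T.κ T.e₁, true) := T.y_zpow j _

theorem mul_κ (z : ℤ) (m : M) : (z * 4) • T.κ m = 0 := by
  rw [mul_smul, T.four_κ, smul_zero]

theorem y_mul_x_even {c : ℤ} (hc : T.κ T.e₁ = (4 * c) • T.e₁ + (8 * c) • T.e₂) (k : ℤ) :
    T.y * T.x ^ (2 * k) = T.x ^ (2 * (k + 4 * c * k)) * T.y ^ (1 + 8 * c * k) := by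
  ext1 ⟨m, b⟩
  have h1 := T.mul_κ (2 * c * k) m
  have h2 := T.mul_κ (c * k * (1 + 8 * c * k)) T.e₁
  have h3 : k • T.κ T.e₁ = (4 * c * k) • T.e₁ + (8 * c * k) • T.e₂ := by rw [hc]; module
  cases b
  · simp only [Equiv.Perm.mul_apply, x_zpow_two_mul, y_zpow_false, y_false, map_add, map_zsmul, h3]
    congr 1
    linear_combination (norm := module) -h1
  · have ht : (1 + 8 * c * k) * (1 + 8 * c * k - 1) / 2 = c * k * (1 + 8 * c * k) * 4 := by
      rw [show (1 + 8 * c * k) * (1 + 8 * c * k - 1) = c * k * (1 + 8 * c * k) * 4 * 2 by ring,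
        Int.mul_ediv_cancel _ two_ne_zero]
    simp only [Equiv.Perm.mul_apply, x_zpow_two_mul, y_zpow_true, y_true, map_add, map_zsmul, h3,
      ht, h2]
    congr 1
    linear_combination (norm := module) h1

theorem y_mul_x_odd {c : ℤ} (hc : T.κ T.e₁ = (4 * c) • T.e₁ + (8 * c) • T.e₂) (k : ℤ) :
    T.y * T.x ^ (2 * k + 1) =
      T.x ^ (2 * (k - 1 - 4 * c * k) + 1) * T.y ^ (-1 - 8 * c * k) := by
  ext1 ⟨m, b⟩
  have h1 := T.mul_κ (2 * c * k) m
  have h3 : k • T.κ T.e₁ = (4 * c * k) • T.e₁ + (8 * c * k) • T.e₂ := by rw [hc]; module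
  cases b
  · simp only [Equiv.Perm.mul_apply, x_zpow_two_mul_add_one, x_false, y_zpow_false, y_true,
      map_add, map_zsmul, h3]
    congr 1
    linear_combination (norm := module) h1
  · have ht : (-1 - 8 * c * k) * (-1 - 8 * c * k - 1) / 2 =
        1 + (3 * c * k + 8 * c * k * c * k) * 4 := by
      rw [show (-1 - 8 * c * k) * (-1 - 8 * c * k - 1) =
        (1 + (3 * c * k + 8 * c * k * c * k) * 4) * 2 by ring, Int.mul_ediv_cancel _ two_ne_zero]
    have h2 := T.mul_κ (3 * c * k + 8 * c * k * c * k) T.e₁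
    simp only [Equiv.Perm.mul_apply, x_zpow_two_mul_add_one, x_true, y_zpow_true, y_false,
      map_add, map_zsmul, h3, ht, add_smul _ _ (T.κ T.e₁), h2, one_smul]
    congr 1
    linear_combination (norm := module) -h1

theorem commutator {c : ℤ} (hc : T.κ T.e₁ = (4 * c) • T.e₁ + (8 * c) • T.e₂) :
    (T.x ^ 2)⁻¹ * T.y * T.x ^ 2 * T.y⁻¹ = T.x ^ (8 * c) * T.y ^ (8 * c) := by
  have h := T.y_mul_x_even hc 1
  rw [mul_assoc, mul_assoc, inv_mul_eq_iff_eq_mul, ← mul_assoc, mul_inv_eq_iff_eq_mul]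
  calc T.y * T.x ^ 2 = T.y * T.x ^ (2 * 1 : ℤ) := by norm_cast
    _ = _ := by
      rw [h, ← mul_assoc, ← zpow_natCast, ← zpow_add, mul_assoc (T.x ^ _), ← zpow_add_one]
      congr 2 <;> push_cast <;> ring

theorem mirror_commutator_pow (N : ℕ) (m : M) :
    ((T.x ^ 2 * T.y⁻¹ * (T.x ^ 2)⁻¹ * T.y) ^ N) (m, false) = (m + N • T.κ T.e₁, false) := by
  have hx (m : M) : (T.x ^ 2) (m, false) = (m + T.e₁, false) := by simp [pow_two]
  have hx' (m : M) : (T.x ^ 2)⁻¹ (m, false) = (m - T.e₁, false) := by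
    rw [Equiv.Perm.inv_eq_iff_eq, hx, sub_add_cancel]
  induction N with
  | zero => simp
  | succ N ih =>
    rw [pow_succ', Equiv.Perm.mul_apply, ih]
    simp only [Equiv.Perm.mul_apply, y_false, hx', y_inv_false, hx, map_add, map_sub, map_nsmul,
      T.κ_κ, T.κ_e₂, smul_zero, map_zero]
    congr 1
    module

theorem inv_zpow_pow {c : ℤ} (hc : T.κ T.e₁ = (4 * c) • T.e₁ + (8 * c) • T.e₂) (N : ℕ) (m : M) :
    ((T.x ^ (-(8 * c)) * T.y ^ (-(8 * c))) ^ N) (m, false) = (m - N • T.κ T.e₁, false) := by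
  induction N with
  | zero => simp
  | succ N ih =>
    have h1 := T.mul_κ (2 * c) m
    rw [pow_succ', Equiv.Perm.mul_apply, ih,
      show -(8 * c) = 2 * (-(4 * c)) by ring]
    simp only [Equiv.Perm.mul_apply, x_zpow_two_mul, y_zpow_false, map_sub, map_nsmul, T.κ_κ]
    congr 1
    rw [add_smul, one_smul, hc]
    linear_combination (norm := module) -h1

theorem zpow_mul_zpow_eq_one {c P : ℤ} (hP : P ∣ 16 * c)
    (hM : ∀ a b : ℤ, a • T.e₁ + b • T.e₂ = 0 ↔ P ∣ a ∧ 32 * c ∣ b) (a b : ℤ) :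
    T.x ^ a * T.y ^ b = 1 ↔ 2 * P ∣ a ∧ 32 * c ∣ b := by
  constructor
  · intro h
    have h1 := congrArg (· (0, false)) h
    simp only [Equiv.Perm.mul_apply, y_zpow_false, Equiv.Perm.one_apply, map_zero, zero_add] at h1
    rcases Int.even_or_odd' a with ⟨i, rfl | rfl⟩
    · rw [x_zpow_two_mul, Prod.mk.injEq, add_comm, hM] at h1
      exact ⟨mul_dvd_mul_left _ h1.1.1, h1.1.2⟩
    · rw [x_zpow_two_mul_add_one] at h1
      simp at h1
  · rintro ⟨⟨i, rfl⟩, ⟨j, rfl⟩⟩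
    ext1 ⟨m, b⟩
    have h0 : (i * P) • T.e₁ = 0 := by simpa using (hM (i * P) 0).2 (by simp)
    have h1 : (32 * c * j) • T.e₁ = 0 := by
      obtain ⟨d, hd⟩ := hP
      simpa using (hM (32 * c * j) 0).2 ⟨⟨d * (2 * j), by linear_combination (2 * j) * hd⟩, by simp⟩
    have h2 : (32 * c * j) • T.e₂ = 0 := by simpa using (hM 0 (32 * c * j)).2 (by simp)
    have h3 := T.mul_κ (8 * c * j) m
    rw [show 8 * c * j * 4 = 32 * c * j by ring] at h3
    rw [show 2 * P * i = 2 * (i * P) by ring]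
    cases b
    · simp [y_zpow_false, x_zpow_two_mul, h0, h2, h3, smul_add]
    · have ht : 32 * c * j * (32 * c * j - 1) / 2 = 4 * c * j * (32 * c * j - 1) * 4 := by
        rw [show 32 * c * j * (32 * c * j - 1) = 4 * c * j * (32 * c * j - 1) * 4 * 2 by ring,
          Int.mul_ediv_cancel _ two_ne_zero]
      simp [y_zpow_true, x_zpow_two_mul, h0, h1, h2, h3, smul_add, ht, T.mul_κ]

theorem four_smul_shear {P c : ℕ} (hP : P ∣ 16 * c) :
    (4 : ℤ) • (((4 * c : ℕ), (8 * c : ℕ)) : ZMod P × ZMod (32 * c)) = 0 := by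
  rw [Prod.smul_mk, Prod.mk_eq_zero, zsmul_eq_mul, zsmul_eq_mul]
  constructor
  · have := (ZMod.natCast_eq_zero_iff (16 * c) P).2 hP
    rw [← this]; push_cast; ring
  · rw [← ZMod.natCast_self (32 * c)]; push_cast; ring

/-- The homomorphism `ℤ / P → ℤ / P × ℤ / 32c` that maps `1` to `(4c, 8c)`. -/
def shear (P c : ℕ) (h4 : 4 ∣ P) (hP : P ∣ 16 * c) : ZMod P →+ ZMod P × ZMod (32 * c) :=
  ZMod.lift P ⟨zmultiplesHom _ (((4 * c : ℕ), (8 * c : ℕ)) : ZMod P × ZMod (32 * c)), by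
    obtain ⟨d, rfl⟩ := h4
    rw [zmultiplesHom_apply, Nat.cast_mul, mul_comm ((4 : ℕ) : ℤ), mul_smul, Nat.cast_ofNat]
    exact (congrArg ((d : ℤ) • ·) (four_smul_shear hP)).trans (smul_zero (d : ℤ))⟩

theorem shear_intCast {P c : ℕ} (h4 : 4 ∣ P) (hP : P ∣ 16 * c) (a : ℤ) :
    shear P c h4 hP a = a • (((4 * c : ℕ), (8 * c : ℕ)) : ZMod P × ZMod (32 * c)) :=
  ZMod.lift_coe _ _ _

/-- The twisted module on `ℤ / P × ℤ / 32c`. -/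
def ofZMod (P c : ℕ) (h4 : 4 ∣ P) (hP : P ∣ 16 * c) : TwistedModule (ZMod P × ZMod (32 * c)) where
  e₁ := (1, 0)
  e₂ := (0, 1)
  κ := (shear P c h4 hP).comp (AddMonoidHom.fst _ _)
  κ_e₂ := by simp
  κ_κ m := by
    obtain ⟨⟨a, b⟩, rfl⟩ : ∃ s : ℤ × ZMod (32 * c), ((s.1 : ZMod P), s.2) = m :=
      ⟨(m.1.cast, m.2), by simp⟩
    simp only [AddMonoidHom.comp_apply, AddMonoidHom.coe_fst, shear_intCast, map_zsmul]
    rw [← Int.cast_natCast, shear_intCast, Nat.cast_mul, mul_smul, Nat.cast_ofNat, smul_comm 4,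
      four_smul_shear hP, smul_zero, smul_zero]
  four_κ m := by
    obtain ⟨a, ha⟩ := ZMod.intCast_surjective m.1
    rw [AddMonoidHom.comp_apply, AddMonoidHom.coe_fst, ← ha, shear_intCast, smul_comm,
      four_smul_shear hP, smul_zero]

section ofZMod

variable {P c : ℕ} (h4 : 4 ∣ P) (hP : P ∣ 16 * c)

theorem ofZMod_κ_e₁ : (ofZMod P c h4 hP).κ (ofZMod P c h4 hP).e₁ =
    (4 * c : ℤ) • (ofZMod P c h4 hP).e₁ + (8 * c : ℤ) • (ofZMod P c h4 hP).e₂ := by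
  change shear P c h4 hP 1 = (4 * c : ℤ) • (1, 0) + (8 * c : ℤ) • (0, 1)
  rw [← Int.cast_one, shear_intCast]
  simp

theorem ofZMod_smul_add_smul (a b : ℤ) :
    a • (ofZMod P c h4 hP).e₁ + b • (ofZMod P c h4 hP).e₂ = 0 ↔
      (P : ℤ) ∣ a ∧ (32 * c : ℤ) ∣ b := by
  change a • ((1, 0) : ZMod P × ZMod (32 * c)) + b • (0, 1) = 0 ↔ _
  have := ZMod.intCast_zmod_eq_zero_iff_dvd b (32 * c)
  push_cast at this
  simp [Prod.ext_iff, ZMod.intCast_zmod_eq_zero_iff_dvd, this]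

end ofZMod

end TwistedModule

/-- A tight chiral pair inside an ambient group, where chirality is witnessed by a relation whose
mirror image does not hold. -/
theorem IsTightChiralPair.of_relation {K : Type*} [Group K] {x y : K} {p q : ℕ} (hp : 3 ≤ p)
    (hq : 3 ≤ q) (hxy : x * y * (x * y) = 1) (hmul : ∀ a : ℤ, ∃ i j : ℤ, y * x ^ a = x ^ i * y ^ j)
    (hfree : ∀ a b : ℤ, x ^ a * y ^ b = 1 ↔ (p : ℤ) ∣ a ∧ (q : ℤ) ∣ b) {N : ℕ} {n : ℤ}
    (hrel : ((x ^ 2)⁻¹ * y * x ^ 2 * y⁻¹) ^ N = (x ^ n * y ^ n) ^ N)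
    (hne : (x ^ 2 * y⁻¹ * (x ^ 2)⁻¹ * y) ^ N ≠ (x ^ (-n) * y ^ (-n)) ^ N) :
    IsTightChiralPair (G := Subgroup.closure {x, y}) ⟨x, Subgroup.subset_closure (by simp)⟩
      ⟨y, Subgroup.subset_closure (by simp)⟩ p q where
  three_le_left := hp
  three_le_right := hq
  mul_mul_self := Subtype.ext hxy
  factor := by
    have hy (g : K) (hg : ∃ a b : ℤ, g = x ^ a * y ^ b) : ∃ a b : ℤ, y * g = x ^ a * y ^ b := by
      obtain ⟨a, b, rfl⟩ := hg
      obtain ⟨i, j, h⟩ := hmul a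
      exact ⟨i, j + b, by rw [← mul_assoc, h, mul_assoc, zpow_add]⟩
    have hyn (n : ℕ) (g : K) (hg : ∃ a b : ℤ, g = x ^ a * y ^ b) :
        ∃ a b : ℤ, y ^ n * g = x ^ a * y ^ b := by
      induction n with
      | zero => simpa using hg
      | succ n ih => rw [pow_succ', mul_assoc]; exact hy _ ih
    have hyq : y⁻¹ = y ^ (q - 1) := by
      have := (hfree 0 q).2 (by simp)
      rw [zpow_zero, one_mul, zpow_natCast] at this
      rw [inv_eq_iff_mul_eq_one, ← pow_succ', Nat.sub_add_cancel (by omega), this]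
    have key (g : K) (hg : g ∈ Subgroup.closure {x, y}) : ∃ a b : ℤ, g = x ^ a * y ^ b := by
      induction hg using Subgroup.closure_induction_left with
      | one => exact ⟨0, 0, by simp⟩
      | mul_left z hz g _ ih =>
        rcases hz with rfl | rfl
        · obtain ⟨a, b, rfl⟩ := ih
          exact ⟨1 + a, b, by rw [zpow_add, zpow_one, mul_assoc]⟩
        · exact hy g ih
      | inv_mul_cancel z hz g _ ih =>
        rcases hz with rfl | rfl
        · obtain ⟨a, b, rfl⟩ := ih
          exact ⟨-1 + a, b, by rw [zpow_add, zpow_neg_one, mul_assoc]⟩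
        · rw [hyq]; exact hyn _ g ih
    rintro ⟨g, hg⟩
    obtain ⟨a, b, h⟩ := key g hg
    exact ⟨a, b, Subtype.ext h⟩
  free a b := by
    rw [← hfree a b, ← Subtype.coe_inj]
    simp
  not_inverted f hx hy := by
    apply hne
    set X : Subgroup.closure {x, y} := ⟨x, Subgroup.subset_closure (by simp)⟩
    set Y : Subgroup.closure {x, y} := ⟨y, Subgroup.subset_closure (by simp)⟩
    have h := congrArg (fun g => (f g : K)) (Subtype.ext (by simpa using hrel) :
      ((X ^ 2)⁻¹ * Y * X ^ 2 * Y⁻¹) ^ N = (X ^ n * Y ^ n) ^ N)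
    simp only [map_pow, map_mul, map_inv, map_zpow, hx, hy] at h
    simpa [X, Y] using h

namespace DihedralGroup

variable (r s : ℕ)

/-- The generator of a product of two dihedral groups that is a rotation in the first factor. -/
def pairLeft : DihedralGroup r × DihedralGroup s := (.r 1, .sr 0)

/-- The generator of a product of two dihedral groups that is a rotation in the second factor. -/
def pairRight : DihedralGroup r × DihedralGroup s := (.sr 0, .r 1)

theorem sr_zero_zpow_two_mul {n : ℕ} (k : ℤ) : (sr 0 : DihedralGroup n) ^ (2 * k) = 1 := by
  rw [zpow_mul, zpow_two, sr_mul_self, one_zpow]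

theorem sr_zero_zpow_two_mul_add_one {n : ℕ} (k : ℤ) :
    (sr 0 : DihedralGroup n) ^ (2 * k + 1) = sr 0 := by
  rw [zpow_add_one, sr_zero_zpow_two_mul, one_mul]

theorem pairLeft_zpow_even (k : ℤ) : pairLeft r s ^ (2 * k) = (.r (2 * k : ℤ), 1) := by
  simp only [pairLeft, Prod.pow_mk, sr_zero_zpow_two_mul, r_one_zpow]

theorem pairLeft_zpow_odd (k : ℤ) : pairLeft r s ^ (2 * k + 1) = (.r (2 * k + 1 : ℤ), .sr 0) := by
  simp only [pairLeft, Prod.pow_mk, sr_zero_zpow_two_mul_add_one, r_one_zpow]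

theorem pairRight_zpow_even (k : ℤ) : pairRight r s ^ (2 * k) = (1, .r (2 * k : ℤ)) := by
  simp only [pairRight, Prod.pow_mk, sr_zero_zpow_two_mul, r_one_zpow]

theorem pair_mul_mul_self :
    pairLeft r s * pairRight r s * (pairLeft r s * pairRight r s) = 1 := by
  simp [pairLeft, pairRight, -r_zero, one_def]

theorem pair_mul_even (k : ℤ) :
    pairRight r s * pairLeft r s ^ (2 * k) = pairLeft r s ^ (2 * (-k)) * pairRight r s := by
  simp [pairLeft_zpow_even, pairRight]

theorem pair_mul_odd (k : ℤ) : pairRight r s * pairLeft r s ^ (2 * k + 1) =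
    pairLeft r s ^ (2 * (-k - 1) + 1) * pairRight r s ^ (-1 : ℤ) := by
  rw [pairLeft_zpow_odd, pairLeft_zpow_odd]
  simp [pairRight]
  ring

theorem pairLeft_zpow_eq_one (a : ℤ) (h : 2 * (r : ℤ) ∣ a) : pairLeft r s ^ a = 1 := by
  obtain ⟨k, rfl⟩ := h
  rw [mul_assoc, pairLeft_zpow_even]
  simp [-r_zero, one_def]

theorem pairRight_zpow_eq_one (a : ℤ) (h : 2 * (s : ℤ) ∣ a) : pairRight r s ^ a = 1 := by
  obtain ⟨k, rfl⟩ := h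
  rw [mul_assoc, pairRight_zpow_even]
  simp [-r_zero, one_def]

theorem pair_free (a b : ℤ) (h : pairLeft r s ^ (2 * a) * pairRight r s ^ (2 * b) = 1) :
    (r : ℤ) ∣ 2 * a ∧ (s : ℤ) ∣ 2 * b := by
  rw [pairLeft_zpow_even, pairRight_zpow_even] at h
  simpa [-r_zero, one_def, Prod.ext_iff, ← ZMod.intCast_zmod_eq_zero_iff_dvd] using h

theorem pair_relation (c : ℤ) :
    ((pairLeft r s ^ 2)⁻¹ * pairRight r s * pairLeft r s ^ 2 * (pairRight r s)⁻¹) ^ (r * s) =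
      (pairLeft r s ^ (2 * c) * pairRight r s ^ (2 * c)) ^ (r * s) := by
  rw [pairLeft_zpow_even, pairRight_zpow_even]
  simp [pairLeft, pairRight, -r_zero, one_def, pow_two]

end DihedralGroup

theorem exists_common_zpow {K L : Type*} [Group K] [Group L] {g : K} {h : L} {m n : ℕ}
    (hmn : m.Coprime n) (hg : g ^ (m : ℤ) = 1) (hh : h ^ (2 * n : ℤ) = 1) {i j : ℤ}
    (hij : 2 ∣ i - j) : ∃ k : ℤ, g ^ k = g ^ i ∧ h ^ k = h ^ j := by
  obtain ⟨u, v, huv⟩ := Nat.isCoprime_iff_coprime.2 hmn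
  obtain ⟨d, hd⟩ := hij
  refine ⟨i + m * ((j - i) * u), ?_, ?_⟩
  · rw [zpow_add, zpow_mul, hg, one_zpow, mul_one]
  · rw [show i + m * ((j - i) * u) = j + 2 * n * (d * v) by
      linear_combination (j - i) * huv + v * n * hd, zpow_add, zpow_mul, hh, one_zpow, mul_one]

theorem exists_tightChiralPair {P c r s : ℕ} (hc : 0 < c) (h4 : 4 ∣ P) (hP : P ∣ 16 * c)
    (hr : Odd r) (hs : Odd s) (hPr : (2 * P).Coprime r) (hcs : (32 * c).Coprime s) :
    ∃ (G : Type) (_ : Group G) (x y : G), IsTightChiralPair x y (2 * P * r) (32 * c * s) := by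
  let T := TwistedModule.ofZMod P c h4 hP
  have hω : T.κ T.e₁ = (4 * c : ℤ) • T.e₁ + (8 * c : ℤ) • T.e₂ := TwistedModule.ofZMod_κ_e₁ h4 hP
  have hM := TwistedModule.ofZMod_smul_add_smul h4 hP
  have hT := T.zpow_mul_zpow_eq_one (by exact_mod_cast hP) hM
  have hP0 : 0 < P := Nat.pos_of_dvd_of_pos hP (by omega)
  have hP4 := Nat.le_of_dvd hP0 h4
  have hr0 := hr.pos
  have hs0 := hs.pos
  have hxT : T.x ^ ((2 * P : ℕ) : ℤ) = 1 := by simpa using (hT (2 * P) 0).2 (by simp)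
  have hyT : T.y ^ ((32 * c : ℕ) : ℤ) = 1 := by simpa using (hT 0 (32 * c)).2 (by simp)
  have hxD := DihedralGroup.pairLeft_zpow_eq_one r s (2 * r) dvd_rfl
  have hyD := DihedralGroup.pairRight_zpow_eq_one r s (2 * s) dvd_rfl
  let x : Equiv.Perm ((ZMod P × ZMod (32 * c)) × Bool) × (DihedralGroup r × DihedralGroup s) :=
    (T.x, DihedralGroup.pairLeft r s)
  let y : Equiv.Perm ((ZMod P × ZMod (32 * c)) × Bool) × (DihedralGroup r × DihedralGroup s) :=
    (T.y, DihedralGroup.pairRight r s)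
  have hmul {a i j i' j' : ℤ} (h : T.y * T.x ^ a = T.x ^ i * T.y ^ j)
      (h' : DihedralGroup.pairRight r s * DihedralGroup.pairLeft r s ^ a =
        DihedralGroup.pairLeft r s ^ i' * DihedralGroup.pairRight r s ^ j')
      (hi : 2 ∣ i - i') (hj : 2 ∣ j - j') : ∃ i j : ℤ, y * x ^ a = x ^ i * y ^ j := by
    obtain ⟨k, hk, hk'⟩ := exists_common_zpow hPr hxT hxD hi
    obtain ⟨l, hl, hl'⟩ := exists_common_zpow hcs hyT hyD hj
    refine ⟨k, l, Prod.ext ?_ ?_⟩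
    · exact h.trans (by rw [← hk, ← hl]; rfl)
    · exact h'.trans (by rw [← hk', ← hl']; rfl)
  refine ⟨_, _, _, _, IsTightChiralPair.of_relation (x := x) (y := y) (N := r * s) (n := 8 * c)
    ?_ ?_ ?_ ?_ ?_ ?_ ?_⟩
  · nlinarith
  · nlinarith
  · exact Prod.ext T.mul_mul_self (DihedralGroup.pair_mul_mul_self r s)
  · intro a
    rcases Int.even_or_odd' a with ⟨k, rfl | rfl⟩
    · refine hmul (j' := 1) (T.y_mul_x_even hω k)
        ((DihedralGroup.pair_mul_even r s k).trans (by rw [zpow_one (DihedralGroup.pairRight r s)])) ?_ ?_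
      · exact ⟨2 * k + 4 * c * k, by ring⟩
      · exact ⟨4 * c * k, by ring⟩
    · refine hmul (T.y_mul_x_odd hω k) (DihedralGroup.pair_mul_odd r s k) ?_ ?_
      · exact ⟨2 * k - 4 * c * k, by ring⟩
      · exact ⟨-(4 * c * k), by ring⟩
  · intro a b
    constructor
    · intro h
      obtain ⟨⟨a', rfl⟩, ⟨b', rfl⟩⟩ := (hT a b).1 (congrArg Prod.fst h)
      have h1 : DihedralGroup.pairLeft r s ^ (2 * (P * a')) *
          DihedralGroup.pairRight r s ^ (2 * (16 * c * b')) = 1 := by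
        rw [show 2 * (P * a') = 2 * P * a' by ring,
          show 2 * (16 * c * b') = 32 * c * b' by ring]
        exact congrArg Prod.snd h
      obtain ⟨h2, h3⟩ := DihedralGroup.pair_free r s _ _ h1
      constructor
      · push_cast
        refine IsCoprime.mul_dvd ?_ (dvd_mul_right _ _) (by rwa [mul_assoc])
        exact_mod_cast Nat.isCoprime_iff_coprime.2 hPr
      · push_cast
        refine IsCoprime.mul_dvd ?_ (dvd_mul_right _ _) 
          (by rwa [show 2 * (16 * c * b') = 32 * c * b' by ring] at h3)
        exact_mod_cast Nat.isCoprime_iff_coprime.2 hcs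
    · rintro ⟨⟨a, rfl⟩, ⟨b, rfl⟩⟩
      refine Prod.ext ((hT _ _).2 ⟨⟨r * a, ?_⟩, ⟨s * b, ?_⟩⟩) ?_
      · push_cast; ring
      · push_cast; ring
      · change DihedralGroup.pairLeft r s ^ (((2 * P * r : ℕ) : ℤ) * a) *
          DihedralGroup.pairRight r s ^ (((32 * c * s : ℕ) : ℤ) * b) = 1
        rw [DihedralGroup.pairLeft_zpow_eq_one, DihedralGroup.pairRight_zpow_eq_one, one_mul]
        · exact ⟨16 * c * b, by push_cast; ring⟩
        · exact ⟨P * a, by push_cast; ring⟩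
  · refine Prod.ext ?_ ?_
    · exact congrArg (· ^ (r * s)) (T.commutator hω)
    · have h := DihedralGroup.pair_relation r s (4 * c)
      rw [show (2 * (4 * c) : ℤ) = 8 * c by ring] at h
      exact h
  · intro h
    have h1 := congrArg (fun g => g.1 (0, false)) h
    have h2 : (0 + (r * s) • T.κ T.e₁, false) = (0 - (r * s) • T.κ T.e₁, false) :=
      (T.mirror_commutator_pow (r * s) 0).symm.trans (h1.trans (T.inv_zpow_pow hω (r * s) 0))
    rw [Prod.mk.injEq, zero_add, zero_sub, hω] at h2
    have h3 : (8 * c * (r * s) : ℤ) • T.e₁ + (16 * c * (r * s) : ℤ) • T.e₂ = 0 := by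
      linear_combination (norm := module) h2.1
    obtain ⟨d, hd⟩ := ((hM _ _).1 h3).2
    have h4 : ((r * s : ℕ) : ℤ) = 2 * d := by
      have : (16 * c : ℤ) ≠ 0 := by positivity
      apply mul_left_cancel₀ this
      push_cast
      linear_combination hd
    obtain ⟨e, he⟩ := hr.mul hs
    omega

theorem mainTheorem11 (r s : ℕ) (hr : 0 < r) (hs : 0 < s) :
    ∃ (P : Type) (_ : PartialOrder P) (M : AbstractPolyhedron P),
      M.HasType (8 * r) (32 * s) ∧ M.IsTight ∧ M.IsChiral := by
  suffices h : ∃ (G : Type) (_ : Group G) (x y : G),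
      IsTightChiralPair x y (8 * r) (32 * s) by
    obtain ⟨G, _, x, y, H⟩ := h
    exact ⟨CosetGeometry x y, H.partialOrder, H.polyhedron, H.hasType, H.isTight, H.isChiral⟩
  obtain ⟨a, r, hr', rfl⟩ := Nat.exists_eq_two_pow_mul_odd hr.ne'
  obtain ⟨b, s, hs', rfl⟩ := Nat.exists_eq_two_pow_mul_odd hs.ne'
  have hco (k : ℕ) {n : ℕ} (hn : Odd n) : (2 ^ k).Coprime n :=
    Nat.Coprime.pow_left _ (Nat.coprime_two_left.2 hn)
  rcases le_total (a + 3) (b + 5) with hab | hab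
  · have := exists_tightChiralPair (P := 2 ^ (a + 2)) (c := 2 ^ b) (by positivity)
      ⟨2 ^ a, by ring⟩ (by
        rw [show 16 * 2 ^ b = 2 ^ (b + 4) by ring]; exact pow_dvd_pow 2 (by omega)) hr' hs'
      (by convert hco (a + 3) hr' using 1; ring) (by convert hco (b + 5) hs' using 1; ring)
    convert this using 6; ring_nf
  · obtain ⟨k, rfl⟩ : ∃ k, a = k + 2 := ⟨a - 2, by omega⟩
    obtain ⟨G, _, x, y, H⟩ := exists_tightChiralPair (P := 2 ^ (b + 4)) (c := 2 ^ k)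
      (by positivity) ⟨2 ^ (b + 2), by ring⟩ (by
        rw [show 16 * 2 ^ k = 2 ^ (k + 4) by ring]; exact pow_dvd_pow 2 (by omega)) hs' hr'
      (by convert hco (b + 5) hs' using 1; ring) (by convert hco (k + 5) hr' using 1; ring)
    refine ⟨G, inferInstance, y⁻¹, x⁻¹, ?_⟩
    convert H.dual using 1 <;> ring
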